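/- Let $p\ge 1$ be an integer and let $W=(W(t))_{t\ge 0}$ be a $p$-dimensional standard Brownian motion (with almost surely continuous paths) on a probability space with probability measure $\mathbb{P}$. For $y\in\mathbb{R}^p$ write $\|y\|_{I_p}=\sqrt{(y^\top y)/p}$, where $I_p$ is the $p\times p$ identity matrix, and for $\eta\in\mathbb{R}$ let $$\mathcal{L}_{p,\eta}=\sup_{1\le s\le t<\infty} t^{-\frac32-\eta}\,\|t\,W(s)-s\,W(t)\|_{I_p}\in[0,\infty].$$ Then, for every fixed $M>0$, $$\mathbb{P}\big(\mathcal{L}_{p,0}\ge M\big)=\mathbb{P}\Big(\sup_{1\le s\le t<\infty} t^{-\frac32}\,\|t\,W(s)-s\,W(t)\|_{I_p}\ge M\Big)=1.$$ Hence $\mathcal{L}_{p,0}=\infty$ almost surely, and $\eta>0$ is necessary for $\mathcal{L}_{p,\eta}$ to be almost surely finite: if $\eta\in\mathbb{R}$ is such that $\mathcal{L}_{p,\eta}<\infty$ almost surely, then $\eta>0$. -/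

import Mathlib

open MeasureTheory ProbabilityTheory
open scoped NNReal ENNReal Matrix

/-- A `p`-dimensional standard Brownian motion `(W t)_{t ≥ 0}` on `(Ω, P)`: a process with values
in `ℝ^p` whose coordinate processes are real standard Brownian motions (with almost surely
continuous paths) that are mutually independent as processes. -/
structure IsStdBrownianMotion {Ω : Type*} [MeasurableSpace Ω] {p : ℕ}
    (W : ℝ≥0 → Ω → (Fin p → ℝ)) (P : Measure Ω) : Prop where
  measurable : ∀ t, Measurable (W t)
  isBrownianReal : ∀ i : Fin p, IsBrownianReal (fun t ω => W t ω i) P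
  indep : iIndepFun (fun (i : Fin p) (ω : Ω) (t : ℝ≥0) => W t ω i) P

/-- The weighted norm `‖y‖_M = √((yᵀ M y) / p)` on `ℝ^p`, for a `p × p` matrix `M`. -/
noncomputable def weightedNorm {p : ℕ} (M : Matrix (Fin p) (Fin p) ℝ) (y : Fin p → ℝ) : ℝ :=
  √((y ⬝ᵥ (M *ᵥ y)) / (p : ℝ))

/-- The supremum `sup_{1 ≤ s ≤ t < ∞} t^{-3/2-η} ‖t w(s) - s w(t)‖_{I_p}` for a path `w`, as an
element of `[0, ∞]`. -/
noncomputable def limitSup {p : ℕ} (η : ℝ) (w : ℝ≥0 → (Fin p → ℝ)) : ℝ≥0∞ :=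
  ⨆ (s : ℝ≥0) (t : ℝ≥0) (_ : 1 ≤ s) (_ : s ≤ t),
    ENNReal.ofReal ((t : ℝ) ^ (-(3 / 2 : ℝ) - η) *
      weightedNorm (1 : Matrix (Fin p) (Fin p) ℝ) ((t : ℝ) • w s - (s : ℝ) • w t))

/-! Time inversion turns one coordinate of `W` into the pre-Brownian motion `Y u = u * W (1 / u)`.
At `t = 1 / u`, `s = t / 2`, that coordinate of the weighted difference is `(Y (2u) - Y u) / (2√u)`,
half a standard Gaussian. Over dyadic `u` these are independent, so a supremum below `M` keeps `N`
of them in a fixed interval of Gaussian mass `q < 1`, an event of probability at most `q ^ N`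
(`abs_inversion_increment_le`, `measure_dyadic_increments_le`). Let `N → ∞`. -/

lemma gaussianReal_Icc_lt_one (C : ℝ) : gaussianReal 0 1 (Set.Icc (-C) C) < 1 := by
  refine lt_of_le_of_ne prob_le_one fun h => ?_
  have h0 : gaussianReal 0 1 (Set.Icc (-C) C)ᶜ = 0 := by
    rwa [prob_compl_eq_zero_iff measurableSet_Icc]
  have h1 : volume (Set.Icc (-C) C)ᶜ = 0 := gaussianReal_absolutelyContinuous' 0 one_ne_zero h0
  have h2 : volume (Set.Ioi C) = 0 :=
    measure_mono_null (fun x hx => by simp only [Set.mem_compl_iff, Set.mem_Icc, not_and]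
                                      intro _; exact not_le.2 hx) h1
  simp at h2

/-- The `N` dyadic increments of a pre-Brownian motion inside `[0, 1]` are all small, relative to
their standard deviation, with a probability that is geometric in `N`. -/
lemma measure_dyadic_increments_le {Ω : Type*} [MeasurableSpace Ω] {P : Measure Ω}
    {Y : ℝ≥0 → Ω → ℝ} (hY : IsPreBrownianReal Y P) (C : ℝ) (N : ℕ) :
    P {ω | ∀ i : Fin N, |Y (2 ^ (i + 1 : ℕ) / 2 ^ N) ω - Y (2 ^ (i : ℕ) / 2 ^ N) ω|
        ≤ C * √(2 ^ (i : ℕ) / 2 ^ N)} ≤ gaussianReal 0 1 (Set.Icc (-C) C) ^ N := by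
  have hmono : Monotone (fun i : Fin (N + 1) => (2 : ℝ≥0) ^ (i : ℕ) / 2 ^ N) := by
    intro i j hij
    have : (i : ℕ) ≤ j := hij
    dsimp only
    gcongr
    norm_num
  have hind := hY.hasIndepIncrements N _ hmono
  have key := hind.meas_iInter (s := fun i : Fin N =>
      (fun ω => Y (2 ^ (i + 1 : ℕ) / 2 ^ N) ω - Y (2 ^ (i : ℕ) / 2 ^ N) ω) ⁻¹'
        {x | |x| ≤ C * √(2 ^ (i : ℕ) / 2 ^ N)}) (fun i => by
    refine ⟨_, ?_, rfl⟩
    exact measurableSet_le (by fun_prop) (by fun_prop))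
  have hset : {ω | ∀ i : Fin N, |Y (2 ^ (i + 1 : ℕ) / 2 ^ N) ω - Y (2 ^ (i : ℕ) / 2 ^ N) ω|
        ≤ C * √(2 ^ (i : ℕ) / 2 ^ N)} = ⋂ i : Fin N,
      (fun ω => Y (2 ^ (i + 1 : ℕ) / 2 ^ N) ω - Y (2 ^ (i : ℕ) / 2 ^ N) ω) ⁻¹'
        {x | |x| ≤ C * √(2 ^ (i : ℕ) / 2 ^ N)} := by
    ext; simp
  rw [hset, key]
  refine (Finset.prod_le_pow_card Finset.univ _ (gaussianReal 0 1 (Set.Icc (-C) C))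
    fun i _ => ?_).trans (by simp)
  have hu : (0 : ℝ) < 2 ^ (i : ℕ) / 2 ^ N := by positivity
  have hsub : HasLaw (Y (2 ^ (i + 1 : ℕ) / 2 ^ N) - Y (2 ^ (i : ℕ) / 2 ^ N))
      (gaussianReal 0 (nndist ((2 ^ (i + 1 : ℕ) / 2 ^ N : ℝ≥0) : ℝ)
        ((2 ^ (i : ℕ) / 2 ^ N : ℝ≥0) : ℝ))) P := hY.hasLaw_sub _ _
  have hlaw := gaussianReal_const_mul hsub (√(2 ^ (i : ℕ) / 2 ^ N))⁻¹
  -- The interval `[u, 2u]` has length `u`, so dividing its increment by `√u` gives variance one for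
  -- every `i`.
  have hvar : NNReal.mk ((√(2 ^ (i : ℕ) / 2 ^ N))⁻¹ ^ 2) (sq_nonneg _) *
      nndist ((2 ^ (i + 1 : ℕ) / 2 ^ N : ℝ≥0) : ℝ) ((2 ^ (i : ℕ) / 2 ^ N : ℝ≥0) : ℝ) = 1 := by
    apply NNReal.eq
    simp only [NNReal.coe_mul, NNReal.coe_mk, coe_nndist, Real.dist_eq, NNReal.coe_one]
    push_cast
    have : (2 : ℝ) ^ (i + 1 : ℕ) / 2 ^ N - 2 ^ (i : ℕ) / 2 ^ N = 2 ^ (i : ℕ) / 2 ^ N := by ring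
    rw [this, abs_of_pos hu, inv_pow, Real.sq_sqrt hu.le, inv_mul_cancel₀ hu.ne']
  rw [mul_zero, hvar] at hlaw
  rw [← hlaw.map_eq, Measure.map_apply_of_aemeasurable hlaw.aemeasurable measurableSet_Icc]
  refine measure_mono fun ω hω => ?_
  have hs : 0 < √(2 ^ (i : ℕ) / 2 ^ N : ℝ) := Real.sqrt_pos.2 hu
  simp only [Set.mem_preimage, Set.mem_ofPred_eq] at hω
  simp only [Set.mem_preimage, ← abs_le, Set.mem_Icc, Pi.sub_apply]
  rw [abs_mul, abs_inv, abs_of_pos hs, inv_mul_le_iff₀ hs, mul_comm]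
  exact hω

lemma abs_apply_le_weightedNorm_one {p : ℕ} (i : Fin p) (y : Fin p → ℝ) :
    |y i| ≤ √p * weightedNorm (1 : Matrix (Fin p) (Fin p) ℝ) y := by
  have hp : (0 : ℝ) < p := by exact_mod_cast i.pos
  rw [weightedNorm, ← Real.sqrt_mul hp.le, mul_div_cancel₀ _ hp.ne', Matrix.one_mulVec]
  refine Real.abs_le_sqrt ?_
  rw [sq]
  exact Finset.single_le_sum (f := fun j => y j * y j) (fun j _ => mul_self_nonneg _)
    (Finset.mem_univ i)

lemma weightedNorm_lt_of_limitSup_lt {p : ℕ} {M : ℝ} {w : ℝ≥0 → Fin p → ℝ}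
    (h : limitSup 0 w < ENNReal.ofReal M) {s t : ℝ≥0} (hs : 1 ≤ s) (hst : s ≤ t) :
    (t : ℝ) ^ (-(3 / 2 : ℝ)) *
      weightedNorm (1 : Matrix (Fin p) (Fin p) ℝ) ((t : ℝ) • w s - (s : ℝ) • w t) < M := by
  have h1 : ENNReal.ofReal ((t : ℝ) ^ (-(3 / 2 : ℝ) - 0) *
      weightedNorm (1 : Matrix (Fin p) (Fin p) ℝ) ((t : ℝ) • w s - (s : ℝ) • w t)) ≤
      limitSup 0 w :=
    le_iSup₂_of_le s t (le_iSup₂_of_le hs hst le_rfl)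
  rw [sub_zero] at h1
  exact (ENNReal.ofReal_lt_ofReal_iff_of_nonneg
    (mul_nonneg (by positivity) (Real.sqrt_nonneg _))).1 (h1.trans_lt h)

/-- The factor `√p` passes from the norm to one coordinate; the 2 comes from `Y (2u) - Y u = 2u² (t
w(s) - s w(t))`. -/
lemma abs_inversion_increment_le {p : ℕ} (i : Fin p) {M : ℝ} {w : ℝ≥0 → Fin p → ℝ}
    (h : limitSup 0 w < ENNReal.ofReal M) {u : ℝ≥0} (hu : 0 < u) (hu' : 2 * u ≤ 1) :
    |(2 * u : ℝ≥0) * w (1 / (2 * u)) i - u * w (1 / u) i| ≤ 2 * √p * M * √u := by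
  have hs : 1 ≤ 1 / (2 * u) := by rw [le_div_iff₀ (by positivity)]; simpa using hu'
  have hst : 1 / (2 * u) ≤ 1 / u :=
    one_div_le_one_div_of_le hu (le_mul_of_one_le_left hu.le one_le_two)
  have hw := weightedNorm_lt_of_limitSup_lt h hs hst
  have hi := abs_apply_le_weightedNorm_one i
    (((1 / u : ℝ≥0) : ℝ) • w (1 / (2 * u)) - ((1 / (2 * u) : ℝ≥0) : ℝ) • w (1 / u))
  set n := weightedNorm (1 : Matrix (Fin p) (Fin p) ℝ)
    (((1 / u : ℝ≥0) : ℝ) • w (1 / (2 * u)) - ((1 / (2 * u) : ℝ≥0) : ℝ) • w (1 / u))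
  simp only [Pi.sub_apply, Pi.smul_apply, smul_eq_mul] at hi
  have hu0 : (0 : ℝ) < u := hu
  have hpow : ((1 / u : ℝ≥0) : ℝ) ^ (-(3 / 2 : ℝ)) = u * √u := by
    push_cast
    rw [one_div, Real.inv_rpow hu0.le, Real.rpow_neg hu0.le, inv_inv, Real.sqrt_eq_rpow]
    nth_rewrite 2 [← Real.rpow_one (u : ℝ)]
    rw [← Real.rpow_add hu0]
    norm_num
  rw [hpow] at hw
  have hsq : √(u : ℝ) * √u = u := Real.mul_self_sqrt hu0.le
  have hsu : 0 < √(u : ℝ) := Real.sqrt_pos.2 hu0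
  have heq : ((2 * u : ℝ≥0) : ℝ) * w (1 / (2 * u)) i - u * w (1 / u) i =
      2 * u ^ 2 * (((1 / u : ℝ≥0) : ℝ) * w (1 / (2 * u)) i -
        ((1 / (2 * u) : ℝ≥0) : ℝ) * w (1 / u) i) := by
    push_cast
    field_simp
  rw [heq, abs_mul, abs_of_pos (by positivity)]
  calc 2 * (u : ℝ) ^ 2 * _ ≤ 2 * (u : ℝ) ^ 2 * (√p * n) := by gcongr
    _ = 2 * √p * √u * (u * √u * n) := by linear_combination (-2 * √p * u * n) * hsq
    _ ≤ 2 * √p * √u * M := by gcongr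
    _ = _ := by ring

lemma ae_le_limitSup_zero {Ω : Type*} [MeasurableSpace Ω] {P : Measure Ω} {p : ℕ} (hp : 1 ≤ p)
    {W : ℝ≥0 → Ω → (Fin p → ℝ)} (hW : IsStdBrownianMotion W P) (M : ℝ) :
    ∀ᵐ ω ∂P, ENNReal.ofReal M ≤ limitSup 0 (fun t => W t ω) := by
  let i : Fin p := ⟨0, hp⟩
  have hY := (hW.isBrownianReal i).toIsPreBrownianReal.inv
  set q := gaussianReal 0 1 (Set.Icc (-(2 * √p * M)) (2 * √p * M))
  have hle : ∀ N : ℕ, P {ω | ¬ ENNReal.ofReal M ≤ limitSup 0 (fun t => W t ω)} ≤ q ^ N := by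
    intro N
    -- Only an inclusion is needed, so the event on the uncountable supremum need not be measurable.
    refine (measure_mono fun ω hω => ?_).trans (measure_dyadic_increments_le hY (2 * √p * M) N)
    intro j
    have hlt : limitSup 0 (fun t => W t ω) < ENNReal.ofReal M := not_le.1 hω
    have h2 : (2 : ℝ≥0) ^ (j + 1 : ℕ) / 2 ^ N = 2 * (2 ^ (j : ℕ) / 2 ^ N) := by ring
    have hj : (2 : ℝ≥0) * (2 ^ (j : ℕ) / 2 ^ N) ≤ 1 := by
      rw [← h2]
      exact div_le_one_of_le₀ (pow_le_pow_right₀ one_le_two j.isLt) zero_le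
    have := abs_inversion_increment_le i hlt (by positivity) hj
    rw [h2]
    simpa using this
  exact le_antisymm (ge_of_tendsto'
    (ENNReal.tendsto_pow_atTop_nhds_zero_of_lt_one (gaussianReal_Icc_lt_one _)) hle) zero_le

lemma limitSup_anti {p : ℕ} (w : ℝ≥0 → Fin p → ℝ) : Antitone (fun η => limitSup η w) := by
  intro η η' h
  refine iSup₂_mono fun s t => iSup₂_mono fun hs hst => ?_
  have ht : (1 : ℝ) ≤ t := by exact_mod_cast hs.trans hst
  exact ENNReal.ofReal_le_ofReal (mul_le_mul_of_nonneg_right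
    (Real.rpow_le_rpow_of_exponent_le ht (by linarith)) (Real.sqrt_nonneg _))

theorem proposition2 {Ω : Type*} [MeasurableSpace Ω] (P : Measure Ω) [IsProbabilityMeasure P]
    (p : ℕ) (hp : 1 ≤ p) (W : ℝ≥0 → Ω → (Fin p → ℝ)) (hW : IsStdBrownianMotion W P) :
    (∀ M : ℝ, 0 < M → ∀ᵐ ω ∂P, ENNReal.ofReal M ≤ limitSup 0 (fun t => W t ω)) ∧
    (∀ᵐ ω ∂P, limitSup 0 (fun t => W t ω) = ∞) ∧
    (∀ η : ℝ, (∀ᵐ ω ∂P, limitSup η (fun t => W t ω) < ∞) → 0 < η) := by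
  have htop : ∀ᵐ ω ∂P, limitSup 0 (fun t => W t ω) = ∞ := by
    filter_upwards [ae_all_iff.2 fun n : ℕ => ae_le_limitSup_zero hp hW (n : ℝ)] with ω hω
    exact ENNReal.eq_top_of_forall_nnreal_le fun r => by
      obtain ⟨n, hn⟩ := exists_nat_ge r
      refine le_trans ?_ (hω n)
      rw [ENNReal.ofReal_natCast]
      exact_mod_cast hn
  refine ⟨fun M _ => ae_le_limitSup_zero hp hW M, htop, fun η hη => ?_⟩
  -- For `η ≤ 0` the supremum dominates the one at `0`, which is infinite, because `t ≥ 1`.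
  by_contra! h
  obtain ⟨ω, hω, hω'⟩ := (htop.and hη).exists
  exact ((limitSup_anti (fun t => W t ω) h).trans_lt hω').ne hω
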